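/- Let $(Y,Z)$ and $(X,Z)$ be random pairs in $\mathbf R\times\mathbf R$ with laws $P_Y$ and $P_X$ (the marginal law of $Z$ may differ between the two), and let $F_Y(t\mid z)=P_Y\{Y\le t\mid Z=z\}$ and $F_X(t\mid z)=P_X\{X\le t\mid Z=z\}$, for $z$ in the support of $Z$ in the respective pair, be the distribution functions of (versions of) the regular conditional laws. Fix $z_0\in\mathbf R$, $\alpha\in(0,1)$ and positive integers $q_y,q_x$, and put $q=q_y+q_x$. From independent i.i.d. samples $(Y_i,Z_i)_{i\le n_y}\sim P_Y$ and $(X_j,Z_j)_{j\le n_x}\sim P_X$, let $S_n=(S_{n,1},\dots,S_{n,q})$ consist of the $q_y$ values $Y_i$ whose $Z_i$ are closest to $z_0$, in increasing order of $|Z_i-z_0|$, followed by the $q_x$ values $X_j$ whose $Z_j$ are closest to $z_0$, in the same order; here $n=\min\{n_y,n_x\}$. Ties in $|Z_i-z_0|$ are broken by an arbitrary measurable rule that may use the $Z$-values of the same sample, the sample order and a randomization independent of the data, but not the outcomes $Y_i,X_j$. For $s\in\mathbf R^q$ let $$T(s)=\sup_{t\in\mathbf R}\Big(\frac1{q_y}\sum_{j=1}^{q_y}I\{s_j\le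 t\}-\frac1{q_x}\sum_{j=q_y+1}^{q}I\{s_j\le t\}\Big).$$ For $U_1,\dots,U_q$ i.i.d. uniform on $[0,1]$ let $\Delta(u)=\frac1{q_y}\sum_{j=1}^{q_y}I\{U_j\le u\}-\frac1{q_x}\sum_{j=q_y+1}^{q}I\{U_j\le u\}$ and $$c_\alpha(q_y,q)=\inf\Big\{x\in\mathbf R: P\big\{\sup_{u\in(0,1)}\Delta(u)\le x\big\}\ge 1-\alpha\Big\},\qquad \phi(S_n)=I\{T(S_n)>c_\alpha(q_y,q)\}.$$ Assume that, for each of the two pairs: 1. $P\{Z\in(z_0-\varepsilon,z_0+\varepsilon)\}>0$ for every $\varepsilon>0$; 2. for every sequence $z_k\to z_0$ in the support of $Z$, $\sup_{t\in\mathbf R}|F(t\mid z_k)-F(t\mid z_0)|\to0$, where $F$ is $F_Y$, respectively $F_X$; 3. $F_Y(\cdot\mid z_0)$, respectively $F_X(\cdot\mid z_0)$, has finitely many points of discontinuity. Assume further that the null hypothesis $F_Y(t\mid z_0)\le F_X(t\mid z_0)$ for all $t\in\mathbf R$ holds. Then, with $P=P_Y\otimes P_X$ and $q_y,q_x$ fixed,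 $$\limsup_{n\to\infty}E_P[\phi(S_n)]\le\alpha .$$ -/

import Mathlib

open MeasureTheory ProbabilityTheory Filter Topology

namespace CSD

noncomputable section

/-- `κ` is a version of the conditional law of `W` given `Z = z`, where `P` is the joint law of the
pair `(W, Z)`: drawing `Z` from its marginal and then `W` from `κ Z` reproduces `P`. -/
def IsCondLaw (P : Measure (ℝ × ℝ)) (κ : Kernel ℝ ℝ) : Prop :=
  P.snd ⊗ₘ κ = P.map Prod.swap

/-- The conditional distribution function `F(t | z) = P(W ≤ t | Z = z)`. -/
def condDF (κ : Kernel ℝ ℝ) (t z : ℝ) : ℝ := (κ z).real (Set.Iic t)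

/-- `P{Z ∈ (z - ε, z + ε)} > 0` for every `ε > 0`. -/
def LocallyDense (P : Measure (ℝ × ℝ)) (z : ℝ) : Prop :=
  ∀ ε : ℝ, 0 < ε → 0 < P {p | p.2 ∈ Set.Ioo (z - ε) (z + ε)}

/-- `sup_t |F(t | z_k) - F(t | z)| → 0` for every sequence `z_k → z`. The conditional distribution
function is only defined on the support of `Z`, so the sequences run in that support. -/
def UniformlyContinuousDFAt (P : Measure (ℝ × ℝ)) (κ : Kernel ℝ ℝ) (z : ℝ) : Prop :=
  ∀ u : ℕ → ℝ, (∀ k, u k ∈ P.snd.support) → Tendsto u atTop (𝓝 z) →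
    Tendsto (fun k => ⨆ t : ℝ, |condDF κ t (u k) - condDF κ t z|) atTop (𝓝 0)

/-- `F(· | z)` has finitely many points of discontinuity. -/
def FinitelyManyDiscontinuities (κ : Kernel ℝ ℝ) (z : ℝ) : Prop :=
  {t : ℝ | ¬ ContinuousAt (fun s => condDF κ s z) t}.Finite

/-- The null hypothesis `F_Y(t | z) ≤ F_X(t | z)` for all `t`. -/
def NullHypothesis (κY κX : Kernel ℝ ℝ) (z : ℝ) : Prop :=
  ∀ t : ℝ, condDF κY t z ≤ condDF κX t z

/-- `σ` lists the `n` observations in increasing order of the distance `|Z_i - z₀|`. Ties are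
resolved by an arbitrary measurable rule, which sees the values `Z_1, …, Z_n`, the sample order, and
an external randomisation `v`, but not the outcomes. -/
structure IsDistanceOrdering {V : Type*} [MeasurableSpace V] (z₀ : ℝ) {n : ℕ}
    (σ : (Fin n → ℝ) → V → Equiv.Perm (Fin n)) : Prop where
  sorted : ∀ (z : Fin n → ℝ) (v : V), Monotone fun i => |z (σ z v i) - z₀|
  measurable : ∀ π : Equiv.Perm (Fin n), MeasurableSet {p : (Fin n → ℝ) × V | σ p.1 p.2 = π}

/-- The first `q` induced order statistics `W_[1], …, W_[q]` of the sample `(W_i, Z_i)`, `i < n`.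
They exist when `q ≤ n`; the value `0` for smaller samples plays no role as `n → ∞`. -/
def induced {V : Type*} {n : ℕ} (q : ℕ) (σ : (Fin n → ℝ) → V → Equiv.Perm (Fin n))
    (w : Fin n → ℝ × ℝ) (v : V) : Fin q → ℝ := fun j =>
  if h : j.val < n then (w (σ (fun i => (w i).2) v ⟨j.val, h⟩)).1 else 0

/-- The difference at `t` between the empirical distribution function of the first `qy` entries of
`s` and that of the last `qx` entries of `s`. -/
def ecdfDiff (qy qx : ℕ) (s : Fin (qy + qx) → ℝ) (t : ℝ) : ℝ :=
  (1 / (qy : ℝ)) * ∑ j : Fin qy, (if s (Fin.castAdd qx j) ≤ t then (1 : ℝ) else 0)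
    - (1 / (qx : ℝ)) * ∑ j : Fin qx, (if s (Fin.natAdd qy j) ≤ t then (1 : ℝ) else 0)

/-- The one-sided two-sample Kolmogorov–Smirnov statistic. -/
def ksStat (qy qx : ℕ) (s : Fin (qy + qx) → ℝ) : ℝ := ⨆ t : ℝ, ecdfDiff qy qx s t

/-- The law of `qy + qx` i.i.d. uniform random variables on `[0, 1]`. -/
def uniformLaw (q : ℕ) : Measure (Fin q → ℝ) :=
  Measure.pi fun _ => (volume : Measure ℝ).restrict (Set.Icc 0 1)

/-- The critical value: the `1 - α` quantile of `sup_{u ∈ (0,1)} Δ(u)`, where `Δ` is the difference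
of the empirical distribution functions of i.i.d. uniform random variables. -/
def critVal (α : ℝ) (qy qx : ℕ) : ℝ :=
  sInf {x : ℝ | 1 - α ≤
    (uniformLaw (qy + qx)).real {U | (⨆ u : Set.Ioo (0 : ℝ) 1, ecdfDiff qy qx U u) ≤ x}}

open Classical in
/-- The test `φ(s) = I{T(s) > c_α}`. -/
def ksTest (α : ℝ) (qy qx : ℕ) (s : Fin (qy + qx) → ℝ) : ℝ :=
  if critVal α qy qx < ksStat qy qx s then 1 else 0

/-- The joint law of the two independent i.i.d. samples, of sizes `ny` from `PY` and `nx` from `PX`,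
and of an independent external randomisation with law `ν` (used only to break ties). -/
def dataLaw {V : Type*} [MeasurableSpace V] (PY PX : Measure (ℝ × ℝ)) (ν : Measure V) (ny nx : ℕ) :
    Measure (((Fin ny → ℝ × ℝ) × (Fin nx → ℝ × ℝ)) × V) :=
  ((Measure.pi fun _ => PY).prod (Measure.pi fun _ => PX)).prod ν

/-- The rejection probability `E_P[φ(S_n)]`, where `S_n` is the pooled vector of the first `qy`
induced order statistics of the `Y`-sample and the first `qx` of the `X`-sample. -/
def expectedTest {V : Type*} [MeasurableSpace V] (α : ℝ) (qy qx : ℕ) (PY PX : Measure (ℝ × ℝ))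
    (ν : Measure V) {ny nx : ℕ} (σY : (Fin ny → ℝ) → V → Equiv.Perm (Fin ny))
    (σX : (Fin nx → ℝ) → V → Equiv.Perm (Fin nx)) : ℝ :=
  ∫ ω, ksTest α qy qx (Fin.append (induced qy σY ω.1.1 ω.2) (induced qx σX ω.1.2 ω.2))
    ∂(dataLaw PY PX ν ny nx)

end

end CSD

namespace CSD

/-! ### The Kolmogorov–Smirnov statistic -/

/-! The proof is an exact coupling with uniform variables at each finite sample size. Each outcome
is written as a conditional quantile, `W = Q(Z, U)`, with `U` uniform and independent of the
covariates and of the tie-breaking randomisation (`measurePreserving_quantileData`). The selection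
never looks at the `U`s, so those attached to the selected observations are exactly i.i.d. uniform
(`measurePreserving_selectedUniforms`).

If the selected covariates are so close to `z₀` that the conditional distribution functions have
moved by less than `δ`, then `Y ≤ t` forces `U ≤ F_Y(t|z₀) + δ ≤ F_X(t|z₀) + δ`, while `U ≤
F_X(t|z₀) - δ` forces `X ≤ t`. When no `Y`-uniform lies within `2δ` of an `X`-uniform, the
`δ`-window around `F_X(t|z₀)` cannot contain both kinds, and the statistic is at most `sup Δ` of the
uniforms (`ksStat_le_iSup_Ioo`).

Hence the rejection probability is at most `α`, plus `4δ·qy·qx` for failure of separation, plus the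
probability of too few covariates near `z₀` (`dataLaw_reject_le`). The last term vanishes as `n →
∞`, and `δ` is arbitrary. -/

lemma ecdfDiff_congr {qy qx : ℕ} {s s' : Fin (qy + qx) → ℝ} {t t' : ℝ}
    (h : ∀ j, s j ≤ t ↔ s' j ≤ t') : ecdfDiff qy qx s t = ecdfDiff qy qx s' t' := by
  simp only [ecdfDiff, h]

lemma ecdfDiff_mono {qy qx : ℕ} {s s' : Fin (qy + qx) → ℝ} {t t' : ℝ}
    (hy : ∀ j, s (Fin.castAdd qx j) ≤ t → s' (Fin.castAdd qx j) ≤ t')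
    (hx : ∀ j, s' (Fin.natAdd qy j) ≤ t' → s (Fin.natAdd qy j) ≤ t) :
    ecdfDiff qy qx s t ≤ ecdfDiff qy qx s' t' := by
  unfold ecdfDiff
  gcongr with i _ i _
  · have := hy i
    split_ifs <;> simp_all
  · have := hx i
    split_ifs <;> simp_all

lemma mean_indicator_mem_Icc {q : ℕ} (s : Fin q → ℝ) (t : ℝ) :
    (1 / (q : ℝ)) * ∑ j, (if s j ≤ t then (1 : ℝ) else 0) ∈ Set.Icc (0 : ℝ) 1 := by
  have h1 : ∑ j, (if s j ≤ t then (1 : ℝ) else 0) ≤ q := by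
    calc _ ≤ ∑ _j : Fin q, (1 : ℝ) := Finset.sum_le_sum fun j _ => by split_ifs <;> norm_num
      _ = q := by simp
  constructor
  · exact mul_nonneg (by positivity) (Finset.sum_nonneg fun j _ => by split_ifs <;> norm_num)
  · rw [one_div_mul_eq_div]
    exact div_le_one_of_le₀ h1 (by positivity)

lemma ecdfDiff_mem_Icc {qy qx : ℕ} (s : Fin (qy + qx) → ℝ) (t : ℝ) :
    ecdfDiff qy qx s t ∈ Set.Icc (-1 : ℝ) 1 := by
  have h1 := mean_indicator_mem_Icc (fun j => s (Fin.castAdd qx j)) t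
  have h2 := mean_indicator_mem_Icc (fun j => s (Fin.natAdd qy j)) t
  simp only [Set.mem_Icc] at h1 h2
  constructor <;> unfold ecdfDiff <;> linarith

lemma bddAbove_ecdfDiff {ι : Type*} {qy qx : ℕ} (s : Fin (qy + qx) → ℝ) (f : ι → ℝ) :
    BddAbove (Set.range fun i => ecdfDiff qy qx s (f i)) :=
  ⟨1, by rintro _ ⟨i, rfl⟩; exact (ecdfDiff_mem_Icc s (f i)).2⟩

/-- Right-continuity of step functions. It reduces suprema over `t` to countable ones, whence
measurability; the bound `b` keeps the rational inside `(0, 1)`. -/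
lemma exists_between_forall_le_iff {q : ℕ} (s : Fin q → ℝ) {t b : ℝ} (hb : t < b) :
    ∃ r : ℚ, t < r ∧ r < b ∧ ∀ j, s j ≤ r ↔ s j ≤ t := by
  have h1 : ∀ᶠ x in 𝓝[>] t, ∀ j, s j ≤ x ↔ s j ≤ t := by
    refine eventually_all.2 fun j => ?_
    by_cases h : s j ≤ t
    · filter_upwards [self_mem_nhdsWithin] with x hx
      exact ⟨fun _ => h, fun _ => h.trans (le_of_lt hx)⟩
    · filter_upwards [Ioo_mem_nhdsGT (not_le.1 h)] with x hx
      exact ⟨fun h' => absurd hx.2 (not_lt.2 h'), fun h' => absurd h' h⟩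
  obtain ⟨u, hu, hsub⟩ := mem_nhdsGT_iff_exists_Ioo_subset.1 h1
  obtain ⟨r, hr1, hr2⟩ := exists_rat_btwn (lt_min hu hb)
  exact ⟨r, hr1, hr2.trans_le (min_le_right _ _), hsub ⟨hr1, hr2.trans_le (min_le_left _ _)⟩⟩

lemma measurable_ecdfDiff (qy qx : ℕ) (t : ℝ) :
    Measurable fun s : Fin (qy + qx) → ℝ => ecdfDiff qy qx s t := by
  unfold ecdfDiff
  have h (j : Fin (qy + qx)) :
      Measurable fun s : Fin (qy + qx) → ℝ => if s j ≤ t then (1 : ℝ) else 0 :=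
    Measurable.ite (measurableSet_le (measurable_pi_apply j) measurable_const)
      measurable_const measurable_const
  exact ((Finset.measurable_fun_sum _ fun j _ => h _).const_mul _).sub
    ((Finset.measurable_fun_sum _ fun j _ => h _).const_mul _)

lemma measurableSet_lt_ksStat (qy qx : ℕ) (c : ℝ) :
    MeasurableSet {s : Fin (qy + qx) → ℝ | c < ksStat qy qx s} := by
  have : {s : Fin (qy + qx) → ℝ | c < ksStat qy qx s} =
      ⋃ r : ℚ, {s | c < ecdfDiff qy qx s r} := by
    ext s
    simp only [Set.mem_ofPred_eq, Set.mem_iUnion, ksStat]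
    rw [lt_ciSup_iff (bddAbove_ecdfDiff s fun t => t)]
    constructor
    · rintro ⟨t, ht⟩
      obtain ⟨r, -, -, hr⟩ := exists_between_forall_le_iff s (lt_add_one t)
      exact ⟨r, by rwa [ecdfDiff_congr hr]⟩
    · rintro ⟨r, hr⟩
      exact ⟨r, hr⟩
  rw [this]
  exact MeasurableSet.iUnion fun r => measurableSet_lt measurable_const (measurable_ecdfDiff _ _ _)

instance : Nonempty (Set.Ioo (0 : ℝ) 1) := ⟨⟨1 / 2, by norm_num⟩⟩

lemma measurableSet_iSup_Ioo_le (qy qx : ℕ) (x : ℝ) :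
    MeasurableSet {s : Fin (qy + qx) → ℝ |
      (⨆ u : Set.Ioo (0 : ℝ) 1, ecdfDiff qy qx s u) ≤ x} := by
  have : {s : Fin (qy + qx) → ℝ | (⨆ u : Set.Ioo (0 : ℝ) 1, ecdfDiff qy qx s u) ≤ x} =
      ⋂ r : ℚ, ⋂ _ : (r : ℝ) ∈ Set.Ioo (0 : ℝ) 1, {s | ecdfDiff qy qx s r ≤ x} := by
    ext s
    simp only [Set.mem_ofPred_eq, Set.mem_iInter]
    rw [ciSup_le_iff (bddAbove_ecdfDiff s _)]
    constructor
    · intro h r hr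
      exact h ⟨r, hr⟩
    · rintro h ⟨t, ht⟩
      obtain ⟨r, hr1, hr2, hr⟩ := exists_between_forall_le_iff s ht.2
      rw [← ecdfDiff_congr hr]
      exact h r ⟨ht.1.trans hr1, hr2⟩
  rw [this]
  exact MeasurableSet.iInter fun r => MeasurableSet.iInter fun _ =>
    measurableSet_le (measurable_ecdfDiff _ _ _) measurable_const

/-- When all observations lie in `(0, 1)`, the supremum over `(0, 1)` is the supremum over `ℝ`. -/
lemma ecdfDiff_le_iSup_Ioo {qy qx : ℕ} {U : Fin (qy + qx) → ℝ}
    (hU : ∀ j, U j ∈ Set.Ioo (0 : ℝ) 1) (t : ℝ) :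
    ecdfDiff qy qx U t ≤ ⨆ u : Set.Ioo (0 : ℝ) 1, ecdfDiff qy qx U u := by
  suffices h : ∃ u ∈ Set.Ioo (0 : ℝ) 1, ∀ j, U j ≤ t ↔ U j ≤ u by
    obtain ⟨u, hu, h⟩ := h
    rw [ecdfDiff_congr h]
    exact le_ciSup (bddAbove_ecdfDiff U fun u : Set.Ioo (0 : ℝ) 1 => (u : ℝ)) ⟨u, hu⟩
  rcases le_or_gt t 0 with h0 | h0
  · have : ∀ᶠ u in 𝓝[>] (0 : ℝ), ∀ j, u < U j :=
      eventually_all.2 fun j => by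
        filter_upwards [Ioo_mem_nhdsGT (hU j).1] with u hu using hu.2
    obtain ⟨u, h1, h2⟩ := (this.and (Ioo_mem_nhdsGT one_pos)).exists
    exact ⟨u, h2, fun j => ⟨fun h => absurd ((hU j).1.trans_le h) (not_lt.2 h0),
      fun h => absurd (h1 j) (not_lt.2 h)⟩⟩
  rcases lt_or_ge t 1 with h1 | h1
  · exact ⟨t, ⟨h0, h1⟩, fun j => Iff.rfl⟩
  · have : ∀ᶠ u in 𝓝[<] (1 : ℝ), ∀ j, U j < u :=
      eventually_all.2 fun j => by
        filter_upwards [Ioo_mem_nhdsLT (hU j).2] with u hu using hu.1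
    obtain ⟨u, h3, h4⟩ := (this.and (Ioo_mem_nhdsLT one_pos)).exists
    exact ⟨u, h4, fun j => ⟨fun _ => (h3 j).le, fun _ => (hU j).2.le.trans h1⟩⟩

/-- The statistic of a sample obtained from uniform variables by approximately ordered quantile
transforms is dominated by the statistic of the uniform variables, if those are separated. -/
lemma ksStat_le_iSup_Ioo {qy qx : ℕ} {s U : Fin (qy + qx) → ℝ} {g : ℝ → ℝ} {δ : ℝ}
    (hU : ∀ j, U j ∈ Set.Ioo (0 : ℝ) 1)
    (hsep : ∀ i j, 2 * δ ≤ |U (Fin.castAdd qx i) - U (Fin.natAdd qy j)|)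
    (hy : ∀ j t, s (Fin.castAdd qx j) ≤ t → U (Fin.castAdd qx j) ≤ g t + δ)
    (hx : ∀ j t, U (Fin.natAdd qy j) ≤ g t - δ → s (Fin.natAdd qy j) ≤ t) :
    ksStat qy qx s ≤ ⨆ u : Set.Ioo (0 : ℝ) 1, ecdfDiff qy qx U u := by
  refine ciSup_le fun t => ?_
  -- If the window of half-width `δ` around `g t` contains a `Y`-uniform, separation bars every
  -- `X`-uniform from it, and `g t + δ` serves as comparison point. Otherwise `g t - δ` does.
  by_cases h : ∃ i, U (Fin.castAdd qx i) ∈ Set.Ioc (g t - δ) (g t + δ)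
  · obtain ⟨i, hi⟩ := h
    refine (ecdfDiff_mono (fun j hj => hy j t hj) fun j hj => ?_).trans
      (ecdfDiff_le_iSup_Ioo hU (g t + δ))
    refine hx j t (not_lt.1 fun hlt => ?_)
    have h1 := hsep i j
    rcases le_abs'.1 h1 with h2 | h2 <;> linarith [hi.1, hi.2]
  · refine (ecdfDiff_mono (fun j hj => ?_) fun j hj => hx j t hj).trans
      (ecdfDiff_le_iSup_Ioo hU (g t - δ))
    by_contra hlt
    exact h ⟨j, not_le.1 hlt, hy j t hj⟩

/-! ### The quantile transform of a kernel -/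

open Classical in
/-- The conditional quantile function. -/
noncomputable def condQuantile (κ : Kernel ℝ ℝ) (z u : ℝ) : ℝ :=
  if u ∈ Set.Ioo (0 : ℝ) 1 then sInf {t | u ≤ condDF κ t z} else 0

lemma condDF_eq_cdf (κ : Kernel ℝ ℝ) [IsMarkovKernel κ] (t z : ℝ) :
    condDF κ t z = cdf (κ z) t := (cdf_eq_real _ _).symm

/-- For `u` strictly between 0 and 1 the set defining the quantile is nonempty and bounded below, by
the limits of the distribution function at `±∞`; right-continuity makes the infimum belong to it. -/
lemma condQuantile_le_iff (κ : Kernel ℝ ℝ) [IsMarkovKernel κ] {z u t : ℝ}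
    (hu : u ∈ Set.Ioo (0 : ℝ) 1) : condQuantile κ z u ≤ t ↔ u ≤ condDF κ t z := by
  rw [condQuantile, if_pos hu]
  simp only [condDF_eq_cdf]
  have hbdd : BddBelow {t | u ≤ cdf (κ z) t} := by
    obtain ⟨a, ha⟩ := ((tendsto_cdf_atBot (κ z)).eventually (gt_mem_nhds hu.1)).exists
    refine ⟨a, fun t ht => not_lt.1 fun hlt => ?_⟩
    exact absurd (ht.trans (monotone_cdf (κ z) hlt.le)) (not_le.2 ha)
  have hne : {t | u ≤ cdf (κ z) t}.Nonempty := by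
    obtain ⟨a, ha⟩ := ((tendsto_cdf_atTop (κ z)).eventually (lt_mem_nhds hu.2)).exists
    exact ⟨a, ha.le⟩
  refine ⟨fun h => ?_, fun h => csInf_le hbdd h⟩
  have hright : ∀ᶠ x in 𝓝[>] t, u ≤ cdf (κ z) x := by
    filter_upwards [self_mem_nhdsWithin] with x hx
    obtain ⟨y, hy, hyx⟩ := exists_lt_of_csInf_lt hne (h.trans_lt hx)
    exact le_trans hy (monotone_cdf (κ z) hyx.le)
  have hcont : Tendsto (cdf (κ z)) (𝓝[>] t) (𝓝 (cdf (κ z) t)) :=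
    ((cdf (κ z)).right_continuous t).mono_left (nhdsWithin_mono _ Set.Ioi_subset_Ici_self)
  exact ge_of_tendsto hcont hright

lemma measurable_condDF (κ : Kernel ℝ ℝ) (t : ℝ) : Measurable (condDF κ t) :=
  (κ.measurable_coe measurableSet_Iic).ennreal_toReal

lemma measurable_condQuantile (κ : Kernel ℝ ℝ) [IsMarkovKernel κ] :
    Measurable fun p : ℝ × ℝ => condQuantile κ p.1 p.2 := by
  refine measurable_of_Iic fun t => ?_
  have : (fun p : ℝ × ℝ => condQuantile κ p.1 p.2) ⁻¹' Set.Iic t =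
      ({p | p.2 ∈ Set.Ioo (0 : ℝ) 1} ∩ {p | p.2 ≤ condDF κ t p.1}) ∪
        ({p | p.2 ∈ Set.Ioo (0 : ℝ) 1}ᶜ ∩ {_p | 0 ≤ t}) := by
    ext p
    by_cases hp : p.2 ∈ Set.Ioo (0 : ℝ) 1
    · simp [condQuantile_le_iff κ hp, hp, -Set.mem_Ioo]
    · simp [condQuantile, hp, -Set.mem_Ioo]
  rw [this]
  have h1 : MeasurableSet {p : ℝ × ℝ | p.2 ∈ Set.Ioo (0 : ℝ) 1} := measurable_snd measurableSet_Ioo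
  exact (h1.inter (measurableSet_le measurable_snd ((measurable_condDF κ t).comp measurable_fst))).union
    (h1.compl.inter (MeasurableSet.const _))

/-- The uniform law on `[0, 1]`. -/
noncomputable abbrev unif : Measure ℝ := (volume : Measure ℝ).restrict (Set.Icc 0 1)

instance : IsProbabilityMeasure unif := ⟨by simp⟩

lemma unif_compl_Ioo : unif (Set.Ioo (0 : ℝ) 1)ᶜ = 0 := by
  rw [Measure.restrict_apply measurableSet_Ioo.compl]
  have : (Set.Ioo (0 : ℝ) 1)ᶜ ∩ Set.Icc 0 1 ⊆ {0, 1} := by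
    rintro x ⟨h1, h2, h3⟩
    simp only [Set.mem_compl_iff, Set.mem_Ioo, not_and, not_lt] at h1
    rcases h2.eq_or_lt with h | h
    · simp [h]
    · simp [le_antisymm h3 (h1 h)]
  exact measure_mono_null this (Set.Finite.measure_zero (by simp) _)

lemma map_condQuantile (κ : Kernel ℝ ℝ) [IsMarkovKernel κ] (z : ℝ) :
    unif.map (condQuantile κ z) = κ z := by
  have hm : Measurable (condQuantile κ z) := (measurable_condQuantile κ).comp measurable_prodMk_left
  have := Measure.isProbabilityMeasure_map (μ := unif) hm.aemeasurable
  refine Measure.ext_of_Iic _ _ fun t => ?_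
  rw [Measure.map_apply hm measurableSet_Iic]
  have h0 : 0 ≤ condDF κ t z := measureReal_nonneg
  have h1 : condDF κ t z ≤ 1 := measureReal_le_one
  have : condQuantile κ z ⁻¹' Set.Iic t =ᵐ[unif] Set.Iic (condDF κ t z) := by
    have : ∀ᵐ u ∂unif, u ∈ Set.Ioo (0 : ℝ) 1 := unif_compl_Ioo
    filter_upwards [this] with u hu
    exact propext (condQuantile_le_iff κ hu)
  rw [measure_congr this, Measure.restrict_apply measurableSet_Iic]
  have : Set.Iic (condDF κ t z) ∩ Set.Icc 0 1 = Set.Icc 0 (condDF κ t z) := by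
    ext x; simp only [Set.mem_inter_iff, Set.mem_Iic, Set.mem_Icc]
    exact ⟨fun h => ⟨h.2.1, h.1⟩, fun h => ⟨h.2, h.1, h.2.trans h1⟩⟩
  rw [this, Real.volume_Icc, sub_zero, condDF, ofReal_measureReal]

/-- A pair with conditional law `κ` arises by the quantile transform from its second coordinate and
an independent uniform variable. -/
lemma measurePreserving_condQuantile {P : Measure (ℝ × ℝ)} [IsProbabilityMeasure P]
    {κ : Kernel ℝ ℝ} [IsMarkovKernel κ] (h : IsCondLaw P κ) :
    MeasurePreserving (fun p : ℝ × ℝ => (condQuantile κ p.1 p.2, p.1)) (P.snd.prod unif) P := by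
  have hm : Measurable fun p : ℝ × ℝ => (condQuantile κ p.1 p.2, p.1) :=
    (measurable_condQuantile κ).prodMk measurable_fst
  refine ⟨hm, Measure.ext fun s hs => ?_⟩
  have hP : P = (P.snd ⊗ₘ κ).map Prod.swap := by
    rw [h, Measure.map_map measurable_swap measurable_swap]; simp
  rw [Measure.map_apply hm hs, Measure.prod_apply (hm hs)]
  conv_rhs => rw [hP]
  rw [Measure.map_apply measurable_swap hs, Measure.compProd_apply (measurable_swap hs)]
  refine lintegral_congr fun z => ?_
  have hz : Measurable (condQuantile κ z) := (measurable_condQuantile κ).comp measurable_prodMk_left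
  rw [← map_condQuantile κ z, Measure.map_apply hz (measurable_prodMk_left (measurable_swap hs))]
  rfl

/-! ### The uniform law and the critical value -/

instance (q : ℕ) : IsProbabilityMeasure (uniformLaw q) := by
  unfold uniformLaw; infer_instance

/-- Every level strictly above the critical value has exceedance probability at most `α`. Continuity
of measure from below transfers this to the critical value itself, so it need not be shown that the
infimum is attained. -/
lemma uniformLaw_lt_iSup_le {α : ℝ} (hα : α ∈ Set.Ioo (0 : ℝ) 1) (qy qx : ℕ) :
    uniformLaw (qy + qx)
      {U | critVal α qy qx < ⨆ u : Set.Ioo (0 : ℝ) 1, ecdfDiff qy qx U u} ≤ ENNReal.ofReal α := by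
  set M : (Fin (qy + qx) → ℝ) → ℝ := fun U => ⨆ u : Set.Ioo (0 : ℝ) 1, ecdfDiff qy qx U u
  set μ := uniformLaw (qy + qx)
  have hle : ∀ U, M U ≤ 1 := fun U => ciSup_le fun u => (ecdfDiff_mem_Icc U u).2
  have hne : {x : ℝ | 1 - α ≤ μ.real {U | M U ≤ x}}.Nonempty := by
    refine ⟨1, ?_⟩
    have : {U | M U ≤ 1} = Set.univ := Set.eq_univ_of_forall hle
    simp only [Set.mem_ofPred_eq, this, probReal_univ]
    linarith [hα.1]
  have hmeas : ∀ x, MeasurableSet {U | M U ≤ x} := measurableSet_iSup_Ioo_le qy qx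
  have hlt : ∀ x, critVal α qy qx < x → μ {U | x < M U} ≤ ENNReal.ofReal α := by
    intro x hx
    obtain ⟨y, hy, hyx⟩ := exists_lt_of_csInf_lt hne hx
    have : {U | x < M U} = {U | M U ≤ x}ᶜ := by ext U; simp
    rw [this, ← ofReal_measureReal]
    apply ENNReal.ofReal_le_ofReal
    rw [probReal_compl_eq_one_sub (hmeas x)]
    have h1 : μ.real {U | M U ≤ y} ≤ μ.real {U | M U ≤ x} :=
      measureReal_mono fun U (hU : M U ≤ y) => hU.trans hyx.le
    have h2 : 1 - α ≤ μ.real {U | M U ≤ y} := hy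
    linarith
  have hU : {U | critVal α qy qx < M U} =
      ⋃ k : ℕ, {U | critVal α qy qx + 1 / ((k : ℝ) + 1) < M U} := by
    ext U
    simp only [Set.mem_ofPred_eq, Set.mem_iUnion]
    constructor
    · intro h
      obtain ⟨k, hk⟩ := exists_nat_one_div_lt (sub_pos.2 h)
      exact ⟨k, by linarith⟩
    · rintro ⟨k, hk⟩
      have : 0 < 1 / ((k : ℝ) + 1) := by positivity
      linarith
  have hmono : Monotone fun k : ℕ => {U | critVal α qy qx + 1 / ((k : ℝ) + 1) < M U} := by
    intro k l hkl U hU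
    have : 1 / ((l : ℝ) + 1) ≤ 1 / ((k : ℝ) + 1) := Nat.one_div_le_one_div hkl
    have hU' : critVal α qy qx + 1 / ((k : ℝ) + 1) < M U := hU
    exact lt_of_le_of_lt (by linarith) hU'
  rw [hU, hmono.measure_iUnion]
  exact iSup_le fun k => hlt _ (by have : 0 < 1 / ((k : ℝ) + 1) := by positivity
                                   linarith)

lemma uniformLaw_ae_mem_Ioo (q : ℕ) : ∀ᵐ U ∂uniformLaw q, ∀ j, U j ∈ Set.Ioo (0 : ℝ) 1 := by
  refine ae_all_iff.2 fun j => ?_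
  exact (measurePreserving_eval (fun _ : Fin q => unif) j).quasiMeasurePreserving.ae
    (show ∀ᵐ u ∂unif, u ∈ Set.Ioo (0 : ℝ) 1 from unif_compl_Ioo)

/-- Given one coordinate, the other, being independent, must fall in an interval of length `2δ`. -/
lemma uniformLaw_abs_sub_lt_le {q : ℕ} {i j : Fin q} (hij : i ≠ j) (δ : ℝ) :
    uniformLaw q {U | |U i - U j| < δ} ≤ ENNReal.ofReal (2 * δ) := by
  have hind : IndepFun (fun U : Fin q → ℝ => U i) (fun U => U j) (uniformLaw q) :=
    (iIndepFun_pi (μ := fun _ : Fin q => unif) (X := fun _ => id)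
      fun _ => aemeasurable_id).indepFun hij
  have hmap := (indepFun_iff_map_prod_eq_prod_map_map (measurable_pi_apply i).aemeasurable
    (measurable_pi_apply j).aemeasurable).1 hind
  have h1 (k : Fin q) : (uniformLaw q).map (fun U => U k) = unif :=
    (measurePreserving_eval (fun _ : Fin q => unif) k).map_eq
  rw [h1, h1] at hmap
  have hs : MeasurableSet {p : ℝ × ℝ | |p.1 - p.2| < δ} :=
    measurableSet_lt (by fun_prop) measurable_const
  have : uniformLaw q {U | |U i - U j| < δ} =
      (unif.prod unif) {p : ℝ × ℝ | |p.1 - p.2| < δ} := by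
    rw [← hmap, Measure.map_apply (by fun_prop) hs]; rfl
  rw [this, Measure.prod_apply hs]
  calc _ ≤ ∫⁻ _x, ENNReal.ofReal (2 * δ) ∂unif := lintegral_mono fun x => ?_
    _ = _ := by simp
  refine (Measure.restrict_apply_le _ _).trans ?_
  have : Prod.mk x ⁻¹' {p : ℝ × ℝ | |p.1 - p.2| < δ} = Set.Ioo (x - δ) (x + δ) := by
    ext y
    simp only [Set.mem_preimage, Set.mem_ofPred_eq, Set.mem_Ioo, abs_lt]
    constructor <;> rintro ⟨h1, h2⟩ <;> constructor <;> linarith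
  rw [this, Real.volume_Ioo]
  exact le_of_eq (by ring_nf)

lemma uniformLaw_not_separated_le (qy qx : ℕ) (δ : ℝ) :
    uniformLaw (qy + qx) {U | ∃ i j, |U (Fin.castAdd qx i) - U (Fin.natAdd qy j)| < 2 * δ} ≤
      qy * (qx * ENNReal.ofReal (4 * δ)) := by
  have : {U : Fin (qy + qx) → ℝ | ∃ i j, |U (Fin.castAdd qx i) - U (Fin.natAdd qy j)| < 2 * δ} =
      ⋃ i, ⋃ j, {U | |U (Fin.castAdd qx i) - U (Fin.natAdd qy j)| < 2 * δ} := by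
    ext U; simp
  rw [this]
  refine (measure_iUnion_fintype_le _ _).trans ?_
  calc _ ≤ ∑ _i : Fin qy, ∑ _j : Fin qx, ENNReal.ofReal (4 * δ) := by
        refine Finset.sum_le_sum fun i _ => (measure_iUnion_fintype_le _ _).trans
          (Finset.sum_le_sum fun j _ => ?_)
        refine (uniformLaw_abs_sub_lt_le (fun h => ?_) _).trans (le_of_eq (by ring_nf))
        have := congrArg Fin.val h
        simp at this
        omega
    _ = _ := by simp

/-- Selecting distinct coordinates of an i.i.d. vector gives an i.i.d. vector. -/
lemma measurePreserving_pi_comp {X : Type*} [MeasurableSpace X] {m n : ℕ} (μ : Measure X)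
    [IsProbabilityMeasure μ] {e : Fin m → Fin n} (he : Function.Injective e) :
    MeasurePreserving (fun u : Fin n → X => fun j => u (e j))
      (Measure.pi fun _ => μ) (Measure.pi fun _ => μ) := by
  have hind : iIndepFun (fun (i : Fin n) (u : Fin n → X) => u i) (Measure.pi fun _ => μ) :=
    iIndepFun_pi (μ := fun _ : Fin n => μ) (X := fun _ => id) fun _ => aemeasurable_id
  refine ⟨by fun_prop, ?_⟩
  rw [(iIndepFun_iff_map_fun_eq_pi_map fun j => (measurable_pi_apply (e j)).aemeasurable).1 (hind.precomp he)]
  congr 1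
  funext j
  exact (measurePreserving_eval (fun _ : Fin n => μ) (e j)).map_eq

lemma measurePreserving_finAppend {X : Type*} [MeasurableSpace X] (m n : ℕ) (μ : Measure X)
    [IsProbabilityMeasure μ] :
    MeasurePreserving (fun p : (Fin m → X) × (Fin n → X) => Fin.append p.1 p.2)
      ((Measure.pi fun _ => μ).prod (Measure.pi fun _ => μ)) (Measure.pi fun _ => μ) := by
  have hm : Measurable fun p : (Fin m → X) × (Fin n → X) => Fin.append p.1 p.2 := by
    refine measurable_pi_lambda _ fun i => ?_
    refine Fin.addCases (fun i => ?_) (fun i => ?_) i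
    · simp only [Fin.append_left]; fun_prop
    · simp only [Fin.append_right]; fun_prop
  refine ⟨hm, (Measure.pi_eq fun s hs => ?_).symm⟩
  rw [Measure.map_apply hm (MeasurableSet.univ_pi hs)]
  have : (fun p : (Fin m → X) × (Fin n → X) => Fin.append p.1 p.2) ⁻¹' Set.univ.pi s =
      (Set.univ.pi fun i => s (Fin.castAdd n i)) ×ˢ (Set.univ.pi fun i => s (Fin.natAdd m i)) := by
    ext p
    simp only [Set.mem_preimage, Set.mem_univ_pi, Set.mem_prod]
    constructor
    · intro h
      exact ⟨fun i => by simpa using h (Fin.castAdd n i), fun i => by simpa using h (Fin.natAdd m i)⟩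
    · rintro ⟨h1, h2⟩ i
      refine Fin.addCases (fun i => ?_) (fun i => ?_) i
      · simpa using h1 i
      · simpa using h2 i
  rw [this, Measure.prod_prod, Measure.pi_pi, Measure.pi_pi, Fin.prod_univ_add]

/-- If `f (a, ·)` has law `ξ` for every `a`, then `f` has law `ξ`. -/
lemma measurePreserving_of_forall_section {A B C : Type*} [MeasurableSpace A] [MeasurableSpace B]
    [MeasurableSpace C] {μ : Measure A} [IsProbabilityMeasure μ] {ρ : Measure B}
    [IsProbabilityMeasure ρ] {ξ : Measure C} {f : A × B → C} (hf : Measurable f)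
    (h : ∀ a, MeasurePreserving (fun b => f (a, b)) ρ ξ) :
    MeasurePreserving f (μ.prod ρ) ξ := by
  refine ⟨hf, Measure.ext fun s hs => ?_⟩
  rw [Measure.map_apply hf hs, Measure.prod_apply (hf hs)]
  have (a : A) : ρ (Prod.mk a ⁻¹' (f ⁻¹' s)) = ξ s := (h a).measure_preimage hs.nullMeasurableSet
  simp [this]

/-- There are finitely many permutations, so one splits according to the value of `σ a`. -/
lemma measurable_apply_perm {A β : Type*} [MeasurableSpace A] [MeasurableSpace β] {n : ℕ}
    {σ : A → Equiv.Perm (Fin n)} (hσ : ∀ π, MeasurableSet {a | σ a = π}) {g : A → Fin n → β}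
    (hg : Measurable g) (i : Fin n) : Measurable fun a => g a (σ a i) := by
  intro s hs
  have : (fun a => g a (σ a i)) ⁻¹' s =
      ⋃ π : Equiv.Perm (Fin n), {a | σ a = π} ∩ (fun a => g a (π i)) ⁻¹' s := by
    ext a; simp
  rw [this]
  exact MeasurableSet.iUnion fun π => (hσ π).inter (((measurable_pi_apply _).comp hg) hs)

/-! ### Nearest neighbours -/

/-- The number of observations at distance less than `η` from `z₀`. -/
noncomputable def nearCount {n : ℕ} (z₀ η : ℝ) (z : Fin n → ℝ) : ℕ :=
  (Finset.univ.filter fun i => |z i - z₀| < η).card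

/-- Were the observation at rank `i` not near, sortedness would place all near ones at ranks below
`i`, leaving at most `i < q` of them. -/
lemma abs_sub_lt_of_le_nearCount {V : Type*} [MeasurableSpace V] {z₀ η : ℝ} {n q : ℕ}
    {σ : (Fin n → ℝ) → V → Equiv.Perm (Fin n)} (hσ : IsDistanceOrdering z₀ σ) (z : Fin n → ℝ)
    (v : V) (h : q ≤ nearCount z₀ η z) (i : Fin n) (hi : i.val < q) : |z (σ z v i) - z₀| < η := by
  by_contra hcon
  have hsub : (Finset.univ.filter fun i => |z i - z₀| < η) ⊆ (Finset.Iio i).map (σ z v).toEmbedding := by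
    intro k hk
    rw [Finset.mem_filter] at hk
    refine Finset.mem_map.2 ⟨(σ z v).symm k, ?_, by simp⟩
    rw [Finset.mem_Iio]
    by_contra hle
    have := hσ.sorted z v (not_lt.1 hle)
    simp only [Equiv.apply_symm_apply] at this
    exact hcon (this.trans_lt hk.2)
  have := Finset.card_le_card hsub
  rw [Finset.card_map, Fin.card_Iio] at this
  unfold nearCount at h
  omega

/-- Markov's inequality for `2^(-N)`, where `N` is the near count: by independence its mean is `(1 -
p/2)^n`, with `p` the mass of the neighbourhood. -/
lemma pi_nearCount_lt_le (ζ : Measure ℝ) [IsProbabilityMeasure ζ] (z₀ η : ℝ) (n q : ℕ) :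
    (Measure.pi fun _ : Fin n => ζ) {z | nearCount z₀ η z < q} ≤
      ENNReal.ofReal (2 ^ q * (1 - ζ.real {x | |x - z₀| < η} / 2) ^ n) := by
  classical
  set μ := Measure.pi fun _ : Fin n => ζ
  set B : Set ℝ := {x | |x - z₀| < η}
  have hB : MeasurableSet B := measurableSet_lt (by fun_prop) measurable_const
  -- `f` is `1/2` near `z₀` and `1` elsewhere, so the product of its values is `2^(-N)`.
  set f : ℝ → ℝ := fun x => 1 - B.indicator (fun _ => 1 / 2) x
  have hfm : Measurable f := measurable_const.sub (measurable_const.indicator hB)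
  have hf1 (x : ℝ) : f x = if |x - z₀| < η then 1 / 2 else 1 := by
    by_cases h : |x - z₀| < η
    · have : x ∈ B := h
      simp only [f, Set.indicator_of_mem this, if_pos h]; norm_num
    · have : x ∉ B := h
      simp [f, Set.indicator_of_notMem this, if_neg h]
  have hf0 (x : ℝ) : 0 ≤ f x := by rw [hf1]; split_ifs <;> norm_num
  have hfint : ∫ x, f x ∂ζ = 1 - ζ.real B / 2 := by
    simp only [f]
    rw [integral_sub (integrable_const _) ((integrable_const _).indicator hB),
      integral_indicator_const _ hB]
    simp; ring
  have hprod (z : Fin n → ℝ) : ∏ i, f (z i) = (1 / 2) ^ nearCount z₀ η z := by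
    simp [hf1, Finset.prod_ite, nearCount]
  have hprod1 (z : Fin n → ℝ) : ∏ i, f (z i) ≤ 1 := by
    rw [hprod]; exact pow_le_one₀ (by norm_num) (by norm_num)
  have hPm : Measurable fun z : Fin n → ℝ => ∏ i, f (z i) :=
    Finset.measurable_fun_prod _ fun i _ => hfm.comp (measurable_pi_apply i)
  have hint : Integrable (fun z : Fin n → ℝ => ∏ i, f (z i)) μ :=
    Integrable.of_bound hPm.aestronglyMeasurable 1 (ae_of_all _ fun z => by
      rw [Real.norm_of_nonneg (Finset.prod_nonneg fun i _ => hf0 _)]; exact hprod1 z)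
  have hI : ∫ z, ∏ i, f (z i) ∂μ = (1 - ζ.real B / 2) ^ n := by
    rw [integral_fintype_prod_eq_pow, hfint, Fintype.card_fin]
  have hmarkov := mul_meas_ge_le_integral_of_nonneg
    (ae_of_all μ fun z => Finset.prod_nonneg fun i _ => hf0 (z i)) hint ((1 / 2) ^ q)
  have hle : μ.real {z | nearCount z₀ η z < q} ≤ μ.real {z | (1 / 2 : ℝ) ^ q ≤ ∏ i, f (z i)} := by
    refine measureReal_mono fun z hz => ?_
    simp only [Set.mem_ofPred_eq] at hz ⊢
    rw [hprod]
    exact pow_le_pow_of_le_one (by norm_num) (by norm_num) hz.le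
  rw [← ofReal_measureReal]
  apply ENNReal.ofReal_le_ofReal
  rw [hI] at hmarkov
  have h2 : (2 : ℝ) ^ q * (1 / 2) ^ q = 1 := by rw [← mul_pow]; norm_num
  calc _ ≤ μ.real {z | (1 / 2 : ℝ) ^ q ≤ ∏ i, f (z i)} := hle
    _ = 2 ^ q * ((1 / 2) ^ q * μ.real {z | (1 / 2 : ℝ) ^ q ≤ ∏ i, f (z i)}) := by
        rw [← mul_assoc, h2, one_mul]
    _ ≤ _ := by gcongr

lemma tendsto_pi_nearCount_lt (ζ : Measure ℝ) [IsProbabilityMeasure ζ] {z₀ η : ℝ}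
    (hpos : 0 < ζ {x | |x - z₀| < η}) (q : ℕ) {n : ℕ → ℕ} (hn : Tendsto n atTop atTop) :
    Tendsto (fun k => (Measure.pi fun _ : Fin (n k) => ζ) {z | nearCount z₀ η z < q})
      atTop (𝓝 0) := by
  have hp : 0 < ζ.real {x | |x - z₀| < η} := ENNReal.toReal_pos hpos.ne' (measure_ne_top _ _)
  have hp1 : ζ.real {x | |x - z₀| < η} ≤ 1 := measureReal_le_one
  refine tendsto_of_tendsto_of_tendsto_of_le_of_le tendsto_const_nhds ?_ (fun _ => zero_le)
    fun k => pi_nearCount_lt_le ζ z₀ η (n k) q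
  have h := ((tendsto_pow_atTop_nhds_zero_of_lt_one (r := 1 - ζ.real {x | |x - z₀| < η} / 2)
    (by linarith) (by linarith)).comp hn).const_mul ((2 : ℝ) ^ q)
  simpa using ENNReal.tendsto_ofReal h

/-- The conditional distribution functions are uniformly close to the one at `z` on a neighbourhood
of `z` in the support. -/
lemma UniformlyContinuousDFAt.exists_forall_abs_sub_lt {P : Measure (ℝ × ℝ)} {κ : Kernel ℝ ℝ}
    [IsMarkovKernel κ] {z : ℝ} (h : UniformlyContinuousDFAt P κ z) {δ : ℝ} (hδ : 0 < δ) :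
    ∃ η > 0, ∀ x ∈ P.snd.support, |x - z| < η → ∀ t, |condDF κ t x - condDF κ t z| < δ := by
  by_contra! hcon
  choose! u hu1 hu2 t ht using fun k : ℕ => hcon (1 / ((k : ℝ) + 1)) (by positivity)
  have hlim : Tendsto u atTop (𝓝 z) := by
    rw [tendsto_iff_dist_tendsto_zero]
    refine squeeze_zero (fun _ => dist_nonneg) (fun k => (hu2 k).le)
      tendsto_one_div_add_atTop_nhds_zero_nat
  obtain ⟨k, hk⟩ := ((h u hu1 hlim).eventually (gt_mem_nhds hδ)).exists
  -- A real supremum bounds its terms only when the family is bounded above.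
  have hbdd : BddAbove (Set.range fun t => |condDF κ t (u k) - condDF κ t z|) := by
    refine ⟨1, ?_⟩
    rintro _ ⟨t, rfl⟩
    have h1 : 0 ≤ condDF κ t (u k) := measureReal_nonneg
    have h2 : condDF κ t (u k) ≤ 1 := measureReal_le_one
    have h3 : 0 ≤ condDF κ t z := measureReal_nonneg
    have h4 : condDF κ t z ≤ 1 := measureReal_le_one
    exact abs_le.2 ⟨by linarith, by linarith⟩
  exact absurd ((le_ciSup hbdd (t k)).trans_lt hk) (not_lt.2 (ht k))

/-! ### Coupling of the data with uniform variables -/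

lemma measurePreserving_prodProdProdComm {A B C D : Type*} [MeasurableSpace A] [MeasurableSpace B]
    [MeasurableSpace C] [MeasurableSpace D] (a : Measure A) (b : Measure B) (c : Measure C)
    (d : Measure D) [SFinite a] [SFinite b] [SFinite c] [SFinite d] :
    MeasurePreserving (fun p : (A × B) × (C × D) => ((p.1.1, p.2.1), (p.1.2, p.2.2)))
      ((a.prod b).prod (c.prod d)) ((a.prod c).prod (b.prod d)) := by
  have h1 := measurePreserving_prodAssoc a b (c.prod d)
  have h2 := (measurePreserving_prodAssoc b c d).symm
  have h3 := (Measure.measurePreserving_swap (μ := b) (ν := c)).prod (MeasurePreserving.id d)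
  have h4 := measurePreserving_prodAssoc c b d
  have h5 := (MeasurePreserving.id a).prod (h4.comp (h3.comp h2))
  exact (measurePreserving_prodAssoc a c (b.prod d)).symm.comp (h5.comp h1)

/-- The law of the covariates of both samples and of the external randomisation. -/
noncomputable abbrev covariateLaw {V : Type*} [MeasurableSpace V] (PY PX : Measure (ℝ × ℝ))
    (ν : Measure V) (ny nx : ℕ) : Measure (((Fin ny → ℝ) × (Fin nx → ℝ)) × V) :=
  ((Measure.pi fun _ => PY.snd).prod (Measure.pi fun _ => PX.snd)).prod ν

/-- The law of a pair of independent samples of uniform variables. -/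
noncomputable abbrev uniformPairLaw (ny nx : ℕ) : Measure ((Fin ny → ℝ) × (Fin nx → ℝ)) :=
  (Measure.pi fun _ => unif).prod (Measure.pi fun _ => unif)

/-- The sample with covariates `z` and outcomes the conditional quantiles of order `u`. -/
noncomputable def quantileSample (κ : Kernel ℝ ℝ) {n : ℕ} (z u : Fin n → ℝ) : Fin n → ℝ × ℝ :=
  fun i => (condQuantile κ (z i) (u i), z i)

/-- The data obtained from covariates, external randomisation and uniform variables. -/
noncomputable def quantileData {V : Type*} (κY κX : Kernel ℝ ℝ) {ny nx : ℕ}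
    (p : (((Fin ny → ℝ) × (Fin nx → ℝ)) × V) × ((Fin ny → ℝ) × (Fin nx → ℝ))) :
    ((Fin ny → ℝ × ℝ) × (Fin nx → ℝ × ℝ)) × V :=
  ((quantileSample κY p.1.1.1 p.2.1, quantileSample κX p.1.1.2 p.2.2), p.1.2)

/-- The uniform variables attached to the selected observations. -/
def selectedUniforms {V : Type*} {qy qx ny nx : ℕ} (hy : qy ≤ ny) (hx : qx ≤ nx)
    (σY : (Fin ny → ℝ) → V → Equiv.Perm (Fin ny)) (σX : (Fin nx → ℝ) → V → Equiv.Perm (Fin nx))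
    (p : (((Fin ny → ℝ) × (Fin nx → ℝ)) × V) × ((Fin ny → ℝ) × (Fin nx → ℝ))) :
    Fin (qy + qx) → ℝ :=
  Fin.append (fun j => p.2.1 (σY p.1.1.1 p.1.2 (Fin.castLE hy j)))
    (fun j => p.2.2 (σX p.1.1.2 p.1.2 (Fin.castLE hx j)))

lemma measurePreserving_quantileSample {P : Measure (ℝ × ℝ)} [IsProbabilityMeasure P]
    {κ : Kernel ℝ ℝ} [IsMarkovKernel κ] (h : IsCondLaw P κ) (n : ℕ) :
    MeasurePreserving (fun p : (Fin n → ℝ) × (Fin n → ℝ) => quantileSample κ p.1 p.2)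
      ((Measure.pi fun _ => P.snd).prod (Measure.pi fun _ => unif)) (Measure.pi fun _ => P) :=
  (measurePreserving_pi (fun _ : Fin n => P.snd.prod unif) (fun _ => P)
    fun _ => measurePreserving_condQuantile h).comp
    (measurePreserving_arrowProdEquivProdArrow ℝ ℝ (Fin n) (fun _ => P.snd) fun _ => unif).symm

/-! ### Domination under the coupling and the finite-sample bound -/

section

variable {V : Type*} [MeasurableSpace V] {PY PX : Measure (ℝ × ℝ)} {ν : Measure V}
  {ny nx qy qx : ℕ} {σY : (Fin ny → ℝ) → V → Equiv.Perm (Fin ny)}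
  {σX : (Fin nx → ℝ) → V → Equiv.Perm (Fin nx)} {z₀ : ℝ}

lemma measurable_induced {q n : ℕ} {σ : (Fin n → ℝ) → V → Equiv.Perm (Fin n)}
    (hσ : IsDistanceOrdering z₀ σ) :
    Measurable fun p : (Fin n → ℝ × ℝ) × V => induced q σ p.1 p.2 := by
  refine measurable_pi_lambda _ fun j => ?_
  unfold induced
  split_ifs with h
  · refine measurable_apply_perm (σ := fun p : (Fin n → ℝ × ℝ) × V => σ (fun i => (p.1 i).2) p.2)
      (fun π => ?_) (g := fun p i => (p.1 i).1) (by fun_prop) _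
    exact (show Measurable fun p : (Fin n → ℝ × ℝ) × V => ((fun i => (p.1 i).2), p.2) by fun_prop)
      (hσ.measurable π)
  · exact measurable_const

lemma measurableSet_reject (hσY : IsDistanceOrdering z₀ σY) (hσX : IsDistanceOrdering z₀ σX)
    (c : ℝ) :
    MeasurableSet {ω : ((Fin ny → ℝ × ℝ) × (Fin nx → ℝ × ℝ)) × V | c < ksStat qy qx
      (Fin.append (induced qy σY ω.1.1 ω.2) (induced qx σX ω.1.2 ω.2))} := by
  have hm : Measurable fun ω : ((Fin ny → ℝ × ℝ) × (Fin nx → ℝ × ℝ)) × V =>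
      Fin.append (induced qy σY ω.1.1 ω.2) (induced qx σX ω.1.2 ω.2) := by
    -- Only measurability of `Fin.append` is used; the choice of `unif` is immaterial.
    refine (measurePreserving_finAppend qy qx unif).measurable.comp (Measurable.prodMk ?_ ?_)
    · exact (measurable_induced hσY).comp (show Measurable fun ω : ((Fin ny → ℝ × ℝ) ×
        (Fin nx → ℝ × ℝ)) × V => (ω.1.1, ω.2) by fun_prop)
    · exact (measurable_induced hσX).comp (show Measurable fun ω : ((Fin ny → ℝ × ℝ) ×
        (Fin nx → ℝ × ℝ)) × V => (ω.1.2, ω.2) by fun_prop)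
  exact hm (measurableSet_lt_ksStat qy qx c)

lemma expectedTest_eq (α : ℝ) (hσY : IsDistanceOrdering z₀ σY) (hσX : IsDistanceOrdering z₀ σX) :
    expectedTest α qy qx PY PX ν σY σX = (dataLaw PY PX ν ny nx).real
      {ω | critVal α qy qx < ksStat qy qx
        (Fin.append (induced qy σY ω.1.1 ω.2) (induced qx σX ω.1.2 ω.2))} := by
  rw [← integral_indicator_one (measurableSet_reject hσY hσX _)]
  unfold expectedTest ksTest
  refine integral_congr_ae (ae_of_all _ fun ω => ?_)
  simp only [Set.indicator_apply, Set.mem_ofPred_eq, Pi.one_apply]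

/-- On the event that the selected covariates are close to `z₀` and that the attached uniform
variables are separated, the statistic is dominated by its distribution-free counterpart. -/
lemma ksStat_induced_le {κY κX : Kernel ℝ ℝ} [IsMarkovKernel κY] [IsMarkovKernel κX]
    (hσY : IsDistanceOrdering z₀ σY) (hσX : IsDistanceOrdering z₀ σX)
    (hy : qy ≤ ny) (hx : qx ≤ nx) (hnull : NullHypothesis κY κX z₀) {δ ηY ηX : ℝ}
    (hηY : ∀ x ∈ PY.snd.support, |x - z₀| < ηY → ∀ t, |condDF κY t x - condDF κY t z₀| < δ)
    (hηX : ∀ x ∈ PX.snd.support, |x - z₀| < ηX → ∀ t, |condDF κX t x - condDF κX t z₀| < δ)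
    {p : (((Fin ny → ℝ) × (Fin nx → ℝ)) × V) × ((Fin ny → ℝ) × (Fin nx → ℝ))}
    (hsY : ∀ i, p.1.1.1 i ∈ PY.snd.support) (hsX : ∀ i, p.1.1.2 i ∈ PX.snd.support)
    (hcY : qy ≤ nearCount z₀ ηY p.1.1.1) (hcX : qx ≤ nearCount z₀ ηX p.1.1.2)
    (hU : ∀ j, selectedUniforms hy hx σY σX p j ∈ Set.Ioo (0 : ℝ) 1)
    (hsep : ∀ i j, 2 * δ ≤ |selectedUniforms hy hx σY σX p (Fin.castAdd qx i) -
      selectedUniforms hy hx σY σX p (Fin.natAdd qy j)|) :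
    ksStat qy qx (Fin.append
      (induced qy σY (quantileData κY κX p).1.1 (quantileData κY κX p).2)
      (induced qx σX (quantileData κY κX p).1.2 (quantileData κY κX p).2)) ≤
    ⨆ u : Set.Ioo (0 : ℝ) 1, ecdfDiff qy qx (selectedUniforms hy hx σY σX p) u := by
  -- Both samples are compared with `F_X(·|z₀)`; the null hypothesis is what lets the `Y`-sample be.
  refine ksStat_le_iSup_Ioo (g := fun t => condDF κX t z₀) (δ := δ) hU hsep ?_ ?_
  · intro j t hj
    have hlt : j.val < ny := j.isLt.trans_le hy
    have hUj := hU (Fin.castAdd qx j)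
    simp only [Fin.append_left, induced, hlt, dite_true, selectedUniforms] at hj hUj ⊢
    have h1 : p.2.1 (σY p.1.1.1 p.1.2 (Fin.castLE hy j)) ≤
        condDF κY t (p.1.1.1 (σY p.1.1.1 p.1.2 (Fin.castLE hy j))) :=
      (condQuantile_le_iff κY hUj).1 hj
    have h2 := hηY _ (hsY (σY p.1.1.1 p.1.2 (Fin.castLE hy j)))
      (abs_sub_lt_of_le_nearCount hσY _ p.1.2 hcY (Fin.castLE hy j) j.isLt) t
    have h3 := hnull t
    have h4 := (abs_lt.1 h2).2
    linarith
  · intro j t hj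
    have hlt : j.val < nx := j.isLt.trans_le hx
    have hUj := hU (Fin.natAdd qy j)
    simp only [Fin.append_right, induced, hlt, dite_true, selectedUniforms] at hj hUj ⊢
    have h2 := hηX _ (hsX (σX p.1.1.2 p.1.2 (Fin.castLE hx j)))
      (abs_sub_lt_of_le_nearCount hσX _ p.1.2 hcX (Fin.castLE hx j) j.isLt) t
    have h4 := (abs_lt.1 h2).1
    exact (condQuantile_le_iff κX hUj).2 (show p.2.2 (σX p.1.1.2 p.1.2 (Fin.castLE hx j)) ≤
      condDF κX t (p.1.1.2 (σX p.1.1.2 p.1.2 (Fin.castLE hx j))) by linarith)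

variable [IsProbabilityMeasure PY] [IsProbabilityMeasure PX] [IsProbabilityMeasure ν]
  {κY κX : Kernel ℝ ℝ} [IsMarkovKernel κY] [IsMarkovKernel κX]

lemma measurePreserving_quantileData (hY : IsCondLaw PY κY) (hX : IsCondLaw PX κX) :
    MeasurePreserving (quantileData κY κX)
      ((covariateLaw PY PX ν ny nx).prod (uniformPairLaw ny nx)) (dataLaw PY PX ν ny nx) := by
  set ZZ := (Measure.pi fun _ : Fin ny => PY.snd).prod (Measure.pi fun _ : Fin nx => PX.snd)
  have h1 := measurePreserving_prodAssoc ZZ ν (uniformPairLaw ny nx)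
  have h2 := (MeasurePreserving.id ZZ).prod
    (Measure.measurePreserving_swap (μ := ν) (ν := uniformPairLaw ny nx))
  have h3 := (measurePreserving_prodAssoc ZZ (uniformPairLaw ny nx) ν).symm
  have h4 := measurePreserving_prodProdProdComm (Measure.pi fun _ : Fin ny => PY.snd)
    (Measure.pi fun _ : Fin nx => PX.snd) (Measure.pi fun _ : Fin ny => unif)
    (Measure.pi fun _ : Fin nx => unif)
  have h5 := (measurePreserving_quantileSample hY ny).prod (measurePreserving_quantileSample hX nx)
  exact ((h5.comp h4).prod (MeasurePreserving.id ν)).comp (h3.comp (h2.comp h1))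

/-- With covariates and randomisation frozen, the selection is a fixed injection of indices, under
which i.i.d. uniforms remain i.i.d. uniform. This relies on the tie-breaking rule not seeing the
outcomes. -/
lemma measurePreserving_selectedUniforms (hσY : IsDistanceOrdering z₀ σY)
    (hσX : IsDistanceOrdering z₀ σX) (hy : qy ≤ ny) (hx : qx ≤ nx) :
    MeasurePreserving (selectedUniforms hy hx σY σX)
      ((covariateLaw PY PX ν ny nx).prod (uniformPairLaw ny nx)) (uniformLaw (qy + qx)) := by
  have hm : Measurable (selectedUniforms hy hx σY σX) := by
    refine (measurePreserving_finAppend qy qx unif).measurable.comp (Measurable.prodMk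
      (measurable_pi_lambda _ fun j => ?_) (measurable_pi_lambda _ fun j => ?_))
    · refine measurable_apply_perm (σ := fun p : (((Fin ny → ℝ) × (Fin nx → ℝ)) × V) ×
        ((Fin ny → ℝ) × (Fin nx → ℝ)) => σY p.1.1.1 p.1.2) (fun π => ?_) (g := fun p => p.2.1)
        (by fun_prop) _
      exact (show Measurable fun p : (((Fin ny → ℝ) × (Fin nx → ℝ)) × V) ×
        ((Fin ny → ℝ) × (Fin nx → ℝ)) => (p.1.1.1, p.1.2) by fun_prop) (hσY.measurable π)
    · refine measurable_apply_perm (σ := fun p : (((Fin ny → ℝ) × (Fin nx → ℝ)) × V) ×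
        ((Fin ny → ℝ) × (Fin nx → ℝ)) => σX p.1.1.2 p.1.2) (fun π => ?_) (g := fun p => p.2.2)
        (by fun_prop) _
      exact (show Measurable fun p : (((Fin ny → ℝ) × (Fin nx → ℝ)) × V) ×
        ((Fin ny → ℝ) × (Fin nx → ℝ)) => (p.1.1.2, p.1.2) by fun_prop) (hσX.measurable π)
  refine measurePreserving_of_forall_section hm fun a => ?_
  have h1 := (measurePreserving_pi_comp unif
    ((σY a.1.1 a.2).injective.comp (Fin.castLE_injective hy))).prod
    (measurePreserving_pi_comp unif ((σX a.1.2 a.2).injective.comp (Fin.castLE_injective hx)))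
  exact (measurePreserving_finAppend qy qx unif).comp h1

lemma ae_forall_mem_support (P : Measure (ℝ × ℝ)) [IsProbabilityMeasure P] (n : ℕ) :
    ∀ᵐ z ∂(Measure.pi fun _ : Fin n => P.snd), ∀ i, z i ∈ P.snd.support := by
  refine ae_all_iff.2 fun i => ?_
  exact (measurePreserving_eval (fun _ : Fin n => P.snd) i).quasiMeasurePreserving.ae
    (show ∀ᵐ x ∂P.snd, x ∈ P.snd.support from Measure.support_mem_ae)

/-- Nonasymptotic bound of the rejection probability. -/
lemma dataLaw_reject_le {α : ℝ} (hα : α ∈ Set.Ioo (0 : ℝ) 1)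
    (hκY : IsCondLaw PY κY) (hκX : IsCondLaw PX κX)
    (hσY : IsDistanceOrdering z₀ σY) (hσX : IsDistanceOrdering z₀ σX)
    (hy : qy ≤ ny) (hx : qx ≤ nx) (hnull : NullHypothesis κY κX z₀) {δ ηY ηX : ℝ}
    (hηY : ∀ x ∈ PY.snd.support, |x - z₀| < ηY → ∀ t, |condDF κY t x - condDF κY t z₀| < δ)
    (hηX : ∀ x ∈ PX.snd.support, |x - z₀| < ηX → ∀ t, |condDF κX t x - condDF κX t z₀| < δ) :
    dataLaw PY PX ν ny nx {ω | critVal α qy qx < ksStat qy qx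
        (Fin.append (induced qy σY ω.1.1 ω.2) (induced qx σX ω.1.2 ω.2))} ≤
      ENNReal.ofReal α + qy * (qx * ENNReal.ofReal (4 * δ)) +
        (Measure.pi fun _ : Fin ny => PY.snd) {z | nearCount z₀ ηY z < qy} +
        (Measure.pi fun _ : Fin nx => PX.snd) {z | nearCount z₀ ηX z < qx} := by
  set M := (covariateLaw PY PX ν ny nx).prod (uniformPairLaw ny nx)
  have hU : MeasurePreserving (selectedUniforms hy hx σY σX) M (uniformLaw (qy + qx)) :=
    measurePreserving_selectedUniforms hσY hσX hy hx
  have hfst : MeasurePreserving Prod.fst M (covariateLaw PY PX ν ny nx) := measurePreserving_fst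
  have hfst2 : MeasurePreserving Prod.fst (covariateLaw PY PX ν ny nx)
      ((Measure.pi fun _ => PY.snd).prod (Measure.pi fun _ => PX.snd)) := measurePreserving_fst
  have hZY : MeasurePreserving (fun p => p.1.1.1) M (Measure.pi fun _ : Fin ny => PY.snd) :=
    measurePreserving_fst.comp (hfst2.comp hfst)
  have hZX : MeasurePreserving (fun p => p.1.1.2) M (Measure.pi fun _ : Fin nx => PX.snd) :=
    measurePreserving_snd.comp (hfst2.comp hfst)
  rw [← (measurePreserving_quantileData hκY hκX).measure_preimage
    (measurableSet_reject hσY hσX _).nullMeasurableSet]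
  -- Almost surely the selected uniforms lie in `(0, 1)` and the covariates in the support;
  -- rejection then forces one of four events: `sup Δ` exceeds the critical value, separation fails,
  -- or either sample has too few near covariates.
  have hsub : ∀ᵐ p ∂M, p ∈ (quantileData κY κX ⁻¹' {ω | critVal α qy qx < ksStat qy qx
        (Fin.append (induced qy σY ω.1.1 ω.2) (induced qx σX ω.1.2 ω.2))}) →
      p ∈ (selectedUniforms hy hx σY σX ⁻¹'
          {U | critVal α qy qx < ⨆ u : Set.Ioo (0 : ℝ) 1, ecdfDiff qy qx U u} ∪
        selectedUniforms hy hx σY σX ⁻¹'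
          {U | ∃ i j, |U (Fin.castAdd qx i) - U (Fin.natAdd qy j)| < 2 * δ} ∪
        (fun p => p.1.1.1) ⁻¹' {z | nearCount z₀ ηY z < qy}) ∪
        (fun p => p.1.1.2) ⁻¹' {z | nearCount z₀ ηX z < qx} := by
    filter_upwards [hU.quasiMeasurePreserving.ae (uniformLaw_ae_mem_Ioo (qy + qx)),
      hZY.quasiMeasurePreserving.ae (ae_forall_mem_support PY ny),
      hZX.quasiMeasurePreserving.ae (ae_forall_mem_support PX nx)] with p h1 h2 h3 hp
    by_contra hcon
    simp only [Set.mem_union, Set.mem_preimage, Set.mem_ofPred_eq, not_or, not_lt, not_exists]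
      at hcon hp
    obtain ⟨⟨⟨hc1, hc2⟩, hc3⟩, hc4⟩ := hcon
    have := ksStat_induced_le hσY hσX hy hx hnull hηY hηX h2 h3 hc3 hc4 h1 hc2
    exact absurd (hp.trans_le (this.trans hc1)) (lt_irrefl _)
  refine (measure_mono_ae hsub).trans ?_
  refine (measure_union_le _ _).trans (add_le_add ((measure_union_le _ _).trans
    (add_le_add ((measure_union_le _ _).trans (add_le_add ?_ ?_)) ?_)) ?_)
  · exact (hU.measure_preimage_le _).trans (uniformLaw_lt_iSup_le hα qy qx)
  · exact (hU.measure_preimage_le _).trans (uniformLaw_not_separated_le qy qx δ)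
  · exact hZY.measure_preimage_le _
  · exact hZX.measure_preimage_le _

end

/-! ### Passage to the limit -/

lemma LocallyDense.snd_pos {P : Measure (ℝ × ℝ)} {z : ℝ} (h : LocallyDense P z) {η : ℝ}
    (hη : 0 < η) : 0 < P.snd {x | |x - z| < η} := by
  rw [Measure.snd_apply (measurableSet_lt (by fun_prop) measurable_const)]
  convert h η hη using 2
  ext p
  simp only [Set.mem_preimage, Set.mem_ofPred_eq, Set.mem_Ioo, abs_lt]
  constructor <;> rintro ⟨h1, h2⟩ <;> constructor <;> linarith

end CSD

theorem mainTheorem1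
    (α : ℝ) (hα : α ∈ Set.Ioo (0 : ℝ) 1)
    (qy qx : ℕ) (hqy : 0 < qy) (hqx : 0 < qx)
    (z₀ : ℝ)
    (PY PX : Measure (ℝ × ℝ)) [IsProbabilityMeasure PY] [IsProbabilityMeasure PX]
    (κY κX : Kernel ℝ ℝ) [IsMarkovKernel κY] [IsMarkovKernel κX]
    (hκY : CSD.IsCondLaw PY κY) (hκX : CSD.IsCondLaw PX κX)
    (hZY : CSD.LocallyDense PY z₀) (hZX : CSD.LocallyDense PX z₀)
    (hcY : CSD.UniformlyContinuousDFAt PY κY z₀) (hcX : CSD.UniformlyContinuousDFAt PX κX z₀)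
    (hdY : CSD.FinitelyManyDiscontinuities κY z₀) (hdX : CSD.FinitelyManyDiscontinuities κX z₀)
    (hnull : CSD.NullHypothesis κY κX z₀)
    {V : Type*} [MeasurableSpace V] (ν : Measure V) [IsProbabilityMeasure ν]
    (σY σX : (n : ℕ) → (Fin n → ℝ) → V → Equiv.Perm (Fin n))
    (hσY : ∀ n, CSD.IsDistanceOrdering z₀ (σY n)) (hσX : ∀ n, CSD.IsDistanceOrdering z₀ (σX n))
    (ny nx : ℕ → ℕ) (hn : Tendsto (fun k => min (ny k) (nx k)) atTop atTop) :
    limsup (fun k => CSD.expectedTest α qy qx PY PX ν (σY (ny k)) (σX (nx k))) atTop ≤ α := by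
  have hny : Tendsto ny atTop atTop := tendsto_atTop_mono (fun k => min_le_left _ _) hn
  have hnx : Tendsto nx atTop atTop := tendsto_atTop_mono (fun k => min_le_right _ _) hn
  refine le_of_forall_pos_le_add fun ε hε => ?_
  -- Chosen so that the separation term `4δ·qy·qx` equals `ε/2`; each near-count term will take
  -- `ε/4`.
  set δ : ℝ := ε / (8 * (qy * qx)) with hδ_def
  have hqyR : (0 : ℝ) < qy := by exact_mod_cast hqy
  have hqxR : (0 : ℝ) < qx := by exact_mod_cast hqx
  have hδ : 0 < δ := by positivity
  obtain ⟨ηY, hηY0, hηY⟩ := hcY.exists_forall_abs_sub_lt hδ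
  obtain ⟨ηX, hηX0, hηX⟩ := hcX.exists_forall_abs_sub_lt hδ
  have hε4 : (0 : ENNReal) < ENNReal.ofReal (ε / 4) := by simpa using hε
  have hY := (CSD.tendsto_pi_nearCount_lt PY.snd (hZY.snd_pos hηY0) qy hny).eventually
    (ge_mem_nhds hε4)
  have hX := (CSD.tendsto_pi_nearCount_lt PX.snd (hZX.snd_pos hηX0) qx hnx).eventually
    (ge_mem_nhds hε4)
  have hnonneg : ∀ k, 0 ≤ CSD.expectedTest α qy qx PY PX ν (σY (ny k)) (σX (nx k)) := fun k => by
    rw [CSD.expectedTest_eq α (hσY _) (hσX _)]; exact measureReal_nonneg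
  -- A real `limsup` needs a lower bound on the sequence here; nonnegativity supplies it.
  refine limsup_le_of_le (isCoboundedUnder_le_of_le atTop hnonneg) ?_
  filter_upwards [hY, hX, hny.eventually_ge_atTop qy, hnx.eventually_ge_atTop qx]
    with k hkY hkX hky hkx
  rw [CSD.expectedTest_eq α (hσY _) (hσX _)]
  refine ENNReal.toReal_le_of_le_ofReal (by linarith [hα.1]) ?_
  refine (CSD.dataLaw_reject_le hα hκY hκX (hσY _) (hσX _) hky hkx hnull hηY hηX).trans ?_
  have hcol : (qy : ENNReal) * (qx * ENNReal.ofReal (4 * δ)) = ENNReal.ofReal (ε / 2) := by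
    rw [← ENNReal.ofReal_natCast, ← ENNReal.ofReal_natCast, ← ENNReal.ofReal_mul hqxR.le,
      ← ENNReal.ofReal_mul hqyR.le]
    congr 1
    rw [hδ_def]
    field_simp
    norm_num
  rw [hcol]
  calc _ ≤ ENNReal.ofReal α + ENNReal.ofReal (ε / 2) + ENNReal.ofReal (ε / 4) +
        ENNReal.ofReal (ε / 4) := by gcongr
    _ = ENNReal.ofReal (α + ε) := by
        rw [← ENNReal.ofReal_add hα.1.le (by positivity), ← ENNReal.ofReal_add
          (by linarith [hα.1]) (by positivity), ← ENNReal.ofReal_add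
          (by linarith [hα.1]) (by positivity)]
        congr 1
        ring
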